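/- Let $\mathcal V=(\mathcal V_o,\otimes,e)$ be a commutative quantale, that is, a complete lattice with a commutative monoid structure whose tensor $\otimes$ preserves arbitrary joins in each variable. Assume that $\mathcal V$ is non-trivial ($e\neq\bot$) and integral ($e=\top$). A small $\mathcal V$-category $\mathcal X$ is a set with distances $\mathcal X(x',x)\in\mathcal V_o$ such that $e\le\mathcal X(x,x)$ and $\mathcal X(x',x)\otimes\mathcal X(x'',x')\le\mathcal X(x'',x)$; a $\mathcal V$-functor $f:\mathcal X\to\mathcal Y$ is a map with $\mathcal X(x',x)\le\mathcal Y(fx',fx)$. Let $\mathcal V\text{-}\mathsf{cat}$ be the category of small $\mathcal V$-categories, enriched over itself by $[\mathcal X,\mathcal Y](f,g)=\bigwedge_x\mathcal Y(fx,gx)$. Let $\mathsf{Set}$ be the category of sets, enriched in $\mathcal V\text{-}\mathsf{cat}$ with discrete homs (a $\mathcal V$-category is discrete if all self-distances are $e$ and all other distances are $\bot$), and let $D:\mathsf{Set}\to\mathcal V\text{-}\mathsf{cat}$ be the $\mathcal V\text{-}\mathsf{cat}$-functor that equips a set with the discrete structure. Let $\mathbb N$ be the free $\mathcal V\text{-}\mathsf{cat}$-category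 on the ordinary category with objects all $r\in\mathcal V_o$ and one further object $\mathsf o$, and with non-identity arrows $\delta^r_0,\delta^r_1:r\to\mathsf o$ for every $r$. Let $N:\mathbb N^{op}\to\mathcal V\text{-}\mathsf{cat}$ be the weight that sends $\mathsf o$ to the $\mathcal V$-category $\mathbb 1$ with one object $0$ and $\mathbb 1(0,0)=e$; that sends $r$ to $\mathbb 2_r$ with objects $0,1$ and $\mathbb 2_r(0,0)=\mathbb 2_r(1,1)=e$, $\mathbb 2_r(0,1)=r$, $\mathbb 2_r(1,0)=\bot$; and that sends $\delta^r_i$ to the $\mathcal V$-functor $\mathbb 1\to\mathbb 2_r$ with value $i$. For a small $\mathcal V$-category $\mathcal X$ let $F_{\mathcal X}:\mathbb N\to\mathsf{Set}$ send $\mathsf o$ to the set of objects of $\mathcal X$, $r$ to $X_r=\{(x',x)\mid r\le\mathcal X(x',x)\}$, and $\delta^r_0,\delta^r_1$ to the projections $(x',x)\mapsto x'$ and $(x',x)\mapsto x$. Then for every $\mathcal V\text{-}\mathsf{cat}$-functor $G:\mathcal V\text{-}\mathsf{cat}\to\mathcal V\text{-}\mathsf{cat}$ the following are equivalent: 1.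 There is a $\mathcal V\text{-}\mathsf{cat}$-functor $H:\mathsf{Set}\to\mathcal V\text{-}\mathsf{cat}$ such that $G\cong\mathrm{Lan}_DH$, where $\mathrm{Lan}_DH$ is the $\mathcal V\text{-}\mathsf{cat}$-enriched left Kan extension of $H$ along $D$, i.e. the $\mathcal V\text{-}\mathsf{cat}$-functor given by the weighted colimits $(\mathrm{Lan}_DH)\mathcal X\cong\mathcal V\text{-}\mathsf{cat}(D-,\mathcal X)*H$, $\mathcal V\text{-}\mathsf{cat}$-naturally in $\mathcal X$. 2. $G$ preserves the $\mathcal V\text{-}\mathsf{cat}$-enriched weighted colimit $N*(DF_{\mathcal X})$ of the diagram $(N,DF_{\mathcal X})$ for every small $\mathcal V$-category $\mathcal X$. -/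

import Mathlib

open CategoryTheory Opposite

universe v u w w' u₁ u₂ u₃ v₁ v₂

noncomputable section

/-! Throughout, a commutative quantale is a commutative monoid `V` (tensor `*`, unit `1`) on a
complete lattice such that `*` distributes over arbitrary joins. -/

namespace QuantaleEnriched

section VCategories

variable (V : Type v) [CommMonoid V] [CompleteLattice V]

/-- A `V`-category structure on a set of objects `X`. -/
class VCategory (X : Type w) where
  hom : X → X → V
  one_le_hom : ∀ x, 1 ≤ hom x x
  hom_mul_hom_le : ∀ x'' x' x, hom x' x * hom x'' x' ≤ hom x'' x

/-- The hom-object (distance) `X(x', x)` of a `V`-category. -/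
abbrev vhom {X : Type w} [VCategory V X] (x' x : X) : V := VCategory.hom x' x

/-- A `V`-functor. -/
@[ext]
structure VFunctor (X : Type w) (Y : Type w') [VCategory V X] [VCategory V Y] where
  toFun : X → Y
  vhom_le : ∀ x' x, vhom V x' x ≤ vhom V (toFun x') (toFun x)

variable {V}

/-- A `V`-functor is an isomorphism of `V`-categories if it has a two-sided inverse `V`-functor. -/
def VFunctor.IsIso {X : Type w} {Y : Type w'} [VCategory V X] [VCategory V Y]
    (f : VFunctor V X Y) : Prop :=
  ∃ g : VFunctor V Y X, (∀ x, g.toFun (f.toFun x) = x) ∧ (∀ y, f.toFun (g.toFun y) = y)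

variable [IsQuantale V]

/-- The internal hom `[X, Y]`: `V`-functors, with distance `⨅ x, Y(f x, g x)`. -/
instance VFunctor.instVCategory {X : Type w} {Y : Type w'} [VCategory V X] [VCategory V Y] :
    VCategory V (VFunctor V X Y) where
  hom f g := ⨅ x, vhom V (f.toFun x) (g.toFun x)
  one_le_hom _ := le_iInf fun _ => VCategory.one_le_hom _
  hom_mul_hom_le _ _ _ := le_iInf fun x =>
    (mul_le_mul' (iInf_le _ x) (iInf_le _ x)).trans (VCategory.hom_mul_hom_le _ _ _)

variable (V) in
/-- Small `V`-categories. -/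
structure VCat where
  carrier : Type u
  [str : VCategory V carrier]

attribute [instance] VCat.str

/-- The ordinary category of small `V`-categories and `V`-functors. -/
instance : Category.{u} (VCat.{v, u} V) where
  Hom X Y := VFunctor V X.carrier Y.carrier
  id X := ⟨fun x => x, fun _ _ => le_rfl⟩
  comp f g := ⟨fun x => g.toFun (f.toFun x), fun _ _ => (f.vhom_le _ _).trans (g.vhom_le _ _)⟩

end VCategories

section VCatCategories

variable (V : Type v) [CommMonoid V] [CompleteLattice V]

/-- A `V-cat`-category: a category all of whose hom-sets are the object sets of given
`V`-categories such that composition is a `V`-functor `C(Y, Z) ⊗ C(X, Y) ⟶ C(X, Z)`. (The unit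
`𝟙 ⟶ C(X, X)` is automatically a `V`-functor, and the associativity and unit axioms only concern
objects of the hom-`V`-categories.) -/
class VCatCategory (C : Type u₁) [Category.{v₁} C] where
  homStr : ∀ X Y : C, VCategory V (X ⟶ Y)
  vhom_mul_vhom_le_comp : ∀ {X Y Z : C} (f g : X ⟶ Y) (f' g' : Y ⟶ Z),
    (homStr Y Z).hom f' g' * (homStr X Y).hom f g ≤ (homStr X Z).hom (f ≫ f') (g ≫ g')

attribute [instance, reducible] VCatCategory.homStr

/-- A `V-cat`-functor: a functor whose action on each hom is a `V`-functor. -/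
structure VCatFunctor (C : Type u₁) [Category.{v₁} C] [VCatCategory V C]
    (D : Type u₂) [Category.{v₂} D] [VCatCategory V D] extends C ⥤ D where
  vhom_le_map : ∀ {X Y : C} (f g : X ⟶ Y), vhom V f g ≤ vhom V (map f) (map g)

variable {V}

/-- `V-cat`-functors and `V-cat`-natural transformations. Since `V` is a poset,
`V-cat`-naturality is naturality of the underlying ordinary transformation. -/
instance {C : Type u₁} [Category.{v₁} C] [VCatCategory V C]
    {D : Type u₂} [Category.{v₂} D] [VCatCategory V D] : Category (VCatFunctor V C D) where
  Hom F G := F.toFunctor ⟶ G.toFunctor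
  id F := 𝟙 F.toFunctor
  comp σ τ := NatTrans.vcomp σ τ

/-- Composition of `V-cat`-functors, in diagrammatic order. -/
def VCatFunctor.comp {C : Type u₁} [Category.{v₁} C] [VCatCategory V C]
    {D : Type u₂} [Category.{v₂} D] [VCatCategory V D]
    {E : Type u₃} [Category.{w} E] [VCatCategory V E]
    (F : VCatFunctor V C D) (G : VCatFunctor V D E) : VCatFunctor V C E where
  toFunctor := F.toFunctor ⋙ G.toFunctor
  vhom_le_map f g := (F.vhom_le_map f g).trans (G.vhom_le_map _ _)

/-- The opposite `V-cat`-category. -/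
instance {C : Type u₁} [Category.{v₁} C] [VCatCategory V C] : VCatCategory V Cᵒᵖ where
  homStr X Y :=
    { hom := fun f g => vhom V f.unop g.unop
      one_le_hom := fun _ => VCategory.one_le_hom _
      hom_mul_hom_le := fun _ _ _ => VCategory.hom_mul_hom_le _ _ _ }
  vhom_mul_vhom_le_comp f g f' g' := by
    rw [mul_comm]
    exact VCatCategory.vhom_mul_vhom_le_comp f'.unop g'.unop f.unop g.unop

variable [IsQuantale V]

/-- The hom `[A, C](F, G)` of the functor `V-cat`-category: `V-cat`-natural transformations,
with distance `⨅ a, C(F a, G a)(σ a, τ a)`. -/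
instance VCatFunctor.homVCategory {A : Type u₁} [Category.{v₁} A] [VCatCategory V A]
    {C : Type u₂} [Category.{v₂} C] [VCatCategory V C] (F G : VCatFunctor V A C) :
    VCategory V (F ⟶ G) where
  hom σ τ := ⨅ a, vhom V (NatTrans.app σ a) (NatTrans.app τ a)
  one_le_hom _ := le_iInf fun _ => VCategory.one_le_hom _
  hom_mul_hom_le _ _ _ := le_iInf fun a =>
    (mul_le_mul' (iInf_le _ a) (iInf_le _ a)).trans (VCategory.hom_mul_hom_le _ _ _)

/-- `V-cat` is enriched over itself. -/
instance : VCatCategory V (VCat.{v, u} V) where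
  homStr X Y := inferInstanceAs (VCategory V (VFunctor V X.carrier Y.carrier))
  vhom_mul_vhom_le_comp {X Y Z} f g f' g' := by
    refine le_iInf fun x => ?_
    refine (mul_le_mul' (iInf_le _ (g.toFun x)) ((iInf_le _ x).trans (f'.vhom_le _ _))).trans ?_
    exact VCategory.hom_mul_hom_le _ _ _

end VCatCategories

section Colimits

variable {V : Type v} [CommMonoid V] [CompleteLattice V] [IsQuantale V]
  {A : Type u₁} [Category.{v₁} A] [VCatCategory V A]
  {C : Type u₂} [Category.{u} C] [VCatCategory V C]
  {D : Type u₃} [Category.{u} D] [VCatCategory V D]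

theorem vhom_le_comp_left {X Y Z : C} (k : X ⟶ Y) (f g : Y ⟶ Z) :
    vhom V f g ≤ vhom V (k ≫ f) (k ≫ g) :=
  calc vhom V f g = vhom V f g * 1 := (mul_one _).symm
    _ ≤ vhom V f g * vhom V k k := mul_le_mul' le_rfl (VCategory.one_le_hom k)
    _ ≤ _ := VCatCategory.vhom_mul_vhom_le_comp k k f g

theorem vhom_le_comp_right {X Y Z : C} (f g : X ⟶ Y) (k : Y ⟶ Z) :
    vhom V f g ≤ vhom V (f ≫ k) (g ≫ k) :=
  calc vhom V f g = 1 * vhom V f g := (one_mul _).symm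
    _ ≤ vhom V k k * vhom V f g := mul_le_mul' (VCategory.one_le_hom k) le_rfl
    _ ≤ _ := VCatCategory.vhom_mul_vhom_le_comp f g k k

/-- The presheaf `C(F -, X) : Aᵒᵖ ⟶ V-cat`. -/
def homPresheaf (F : VCatFunctor V A C) (X : C) : VCatFunctor V Aᵒᵖ (VCat.{v, u} V) where
  obj a := ⟨F.obj a.unop ⟶ X⟩
  map k := ⟨fun f => F.map k.unop ≫ f, fun _ _ => vhom_le_comp_left _ _ _⟩
  map_id a := by
    apply VFunctor.ext
    funext f
    change F.map (𝟙 a.unop) ≫ f = f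
    simp
  map_comp k l := by
    apply VFunctor.ext
    funext f
    change F.map (l.unop ≫ k.unop) ≫ f = F.map l.unop ≫ F.map k.unop ≫ f
    simp
  vhom_le_map k l := le_iInf fun f =>
    (F.vhom_le_map k.unop l.unop).trans (vhom_le_comp_right _ _ f)

/-- The transformation `C(F -, f) : C(F -, X) ⟶ C(F -, Y)` given by composing with `f : X ⟶ Y`. -/
def homPresheafMap (F : VCatFunctor V A C) {X Y : C} (f : X ⟶ Y) :
    homPresheaf F X ⟶ homPresheaf F Y :=
  NatTrans.mk
    (fun _ => VFunctor.mk (fun g => g ≫ f) (fun _ _ => vhom_le_comp_right _ _ _))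
    (fun a b k => by
      apply VFunctor.ext
      funext g
      exact Category.assoc (F.map k.unop) g f)

/-- The `V`-functor `C(c, X) ⟶ [Aᵒᵖ, V-cat](W, C(F -, X))` induced by a `W`-weighted cocone
`γ : W ⟶ C(F -, c)` over `F`. -/
def coconeComparison {W : VCatFunctor V Aᵒᵖ (VCat.{v, u} V)} {F : VCatFunctor V A C} {c : C}
    (γ : W ⟶ homPresheaf F c) (X : C) : VFunctor V (c ⟶ X) (W ⟶ homPresheaf F X) where
  toFun f := γ ≫ homPresheafMap F f
  vhom_le f g := le_iInf fun _ => le_iInf fun _ => vhom_le_comp_left _ f g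

/-- The weighted cocone `γ` exhibits `c` as the colimit `W * F`: composing with `γ` is an
isomorphism of `V`-categories `C(c, X) ≅ [Aᵒᵖ, V-cat](W, C(F -, X))` for every `X`. It is natural
in `X`, and by the Yoneda lemma every isomorphism natural in `X` is of this form, with `γ` the
image of the identity of `c`. -/
def IsWeightedColimit {W : VCatFunctor V Aᵒᵖ (VCat.{v, u} V)} {F : VCatFunctor V A C} {c : C}
    (γ : W ⟶ homPresheaf F c) : Prop :=
  ∀ X : C, (coconeComparison γ X).IsIso

/-- The transformation `C(F -, c) ⟶ D(G F -, G c)` given by the action of `G` on homs. -/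
def mapHomPresheaf (F : VCatFunctor V A C) (G : VCatFunctor V C D) (c : C) :
    homPresheaf F c ⟶ homPresheaf (F.comp G) (G.obj c) :=
  NatTrans.mk
    (fun _ => VFunctor.mk (fun f => G.map f) (fun f g => G.vhom_le_map f g))
    (fun a b k => by
      apply VFunctor.ext
      funext f
      exact G.map_comp (F.map k.unop) f)

/-- `G` preserves the colimit of the diagram `(W, F)`: it sends colimit cocones to colimit
cocones. -/
def PreservesWeightedColimit (G : VCatFunctor V C D)
    (W : VCatFunctor V Aᵒᵖ (VCat.{v, u} V)) (F : VCatFunctor V A C) : Prop :=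
  ∀ (c : C) (γ : W ⟶ homPresheaf F c), IsWeightedColimit γ →
    IsWeightedColimit (γ ≫ mapHomPresheaf F G c)

/-- `L` is a left Kan extension of `H` along `J`: there are isomorphisms
`L B ≅ C(J -, B) * H`, natural in `B`. -/
def IsLeftKanExtension (J : VCatFunctor V A C) (H : VCatFunctor V A D)
    (L : VCatFunctor V C D) : Prop :=
  ∃ γ : ∀ B : C, homPresheaf J B ⟶ homPresheaf H (L.obj B),
    (∀ B, IsWeightedColimit (γ B)) ∧
    ∀ (B B' : C) (k : B ⟶ B'),
      homPresheafMap J k ≫ γ B' = γ B ≫ homPresheafMap H (L.map k)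

end Colimits

section Discrete

variable (V : Type v) [CommMonoid V] [CompleteLattice V] [IsQuantale V]

open Classical in
/-- The discrete `V`-category structure on a set. -/
@[reducible]
def discreteStr (X : Type w) : VCategory V X where
  hom x' x := if x' = x then 1 else ⊥
  one_le_hom x := by simp
  hom_mul_hom_le x'' x' x := by
    by_cases h : x' = x
    · subst h; simp
    · simp [h]

theorem discreteStr_hom_self {X : Type w} (x : X) : (discreteStr V X).hom x x = 1 :=
  if_pos rfl

theorem discreteStr_hom_of_ne {X : Type w} {x' x : X} (h : x' ≠ x) :
    (discreteStr V X).hom x' x = ⊥ :=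
  if_neg h

variable {V} in
theorem discreteStr_vhom_le {X : Type w} {Y : Type w'} [VCategory V Y] (f : X → Y) (x' x : X) :
    (discreteStr V X).hom x' x ≤ vhom V (f x') (f x) := by
  by_cases h : x' = x
  · subst h
    rw [discreteStr_hom_self]
    exact VCategory.one_le_hom _
  · rw [discreteStr_hom_of_ne V h]
    exact bot_le

/-- The free `V-cat`-category `D_* C` on an ordinary category `C`: the same objects, and the
discrete `V`-categories on the hom-sets of `C` as homs. -/
def Free (_V : Type v) (C : Type u₁) : Type u₁ := C

instance (C : Type u₁) [Category.{v₁} C] : Category.{v₁} (Free V C) :=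
  inferInstanceAs (Category C)

instance (C : Type u₁) [Category.{v₁} C] : VCatCategory V (Free V C) where
  homStr X Y := discreteStr V (X ⟶ Y)
  vhom_mul_vhom_le_comp f g f' g' := by
    by_cases h : f = g
    · by_cases h' : f' = g'
      · subst h; subst h'
        rw [discreteStr_hom_self, discreteStr_hom_self, discreteStr_hom_self, mul_one]
      · rw [discreteStr_hom_of_ne V h', Quantale.bot_mul]
        exact bot_le
    · rw [discreteStr_hom_of_ne V h, Quantale.mul_bot]
      exact bot_le

/-- Every ordinary functor out of `C` is a `V-cat`-functor out of `D_* C`. -/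
def Free.lift {C : Type u₁} [Category.{v₁} C] {D : Type u₂} [Category.{v₂} D] [VCatCategory V D]
    (F : C ⥤ D) : VCatFunctor V (Free V C) D where
  obj X := F.obj X
  map f := F.map f
  map_id X := F.map_id X
  map_comp f g := F.map_comp f g
  vhom_le_map {X Y} f g :=
    discreteStr_vhom_le (Y := F.obj X ⟶ F.obj Y) (fun k => F.map k) f g

/-- Every ordinary functor `Cᵒᵖ ⥤ D` is a `V-cat`-functor out of the opposite of `D_* C`. -/
def Free.liftOp {C : Type u₁} [Category.{v₁} C] {D : Type u₂} [Category.{v₂} D]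
    [VCatCategory V D] (F : Cᵒᵖ ⥤ D) : VCatFunctor V (Free V C)ᵒᵖ D where
  obj X := F.obj X
  map f := F.map f
  map_id X := F.map_id X
  map_comp f g := F.map_comp f g
  vhom_le_map {X Y} f g :=
    discreteStr_vhom_le (Y := F.obj X ⟶ F.obj Y) (fun k => F.map k.op) f.unop g.unop

/-- Sets, as a `V-cat`-category with discrete homs. -/
abbrev SetV : Type (u + 1) := Free V (Type u)

/-- The ordinary discrete functor. -/
def discreteFunctor : Type u ⥤ VCat.{v, u} V where
  obj X := @VCat.mk V _ _ X (discreteStr V X)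
  map {X Y} f :=
    letI := discreteStr V X
    letI := discreteStr V Y
    ⟨fun x => f x, fun x' x => discreteStr_vhom_le (fun x => f x) x' x⟩

/-- The discrete `V-cat`-functor `D : Set ⟶ V-cat`. -/
def disc : VCatFunctor V (SetV.{v, u} V) (VCat.{v, u} V) :=
  Free.lift V (discreteFunctor V)

end Discrete

section Nerve

variable (V : Type v)

/-- The objects of the shape of `V`-coinserters: a symbol `o` and every element of `V`. -/
inductive NShape : Type v
  | o : NShape
  | el (r : V) : NShape

variable {V} in
/-- The arrows of the shape of `V`-coinserters: besides identities, two arrows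
`δ₀ r, δ₁ r : r ⟶ o` for every `r`. -/
inductive NShape.Hom : NShape V → NShape V → Type v
  | id (a : NShape V) : NShape.Hom a a
  | δ₀ (r : V) : NShape.Hom (.el r) .o
  | δ₁ (r : V) : NShape.Hom (.el r) .o

variable {V} in
/-- Composition of arrows of the shape. -/
def NShape.Hom.comp : {a b c : NShape V} → NShape.Hom a b → NShape.Hom b c → NShape.Hom a c
  | _, _, _, .id _, g => g
  | _, _, _, .δ₀ r, .id _ => .δ₀ r
  | _, _, _, .δ₁ r, .id _ => .δ₁ r

/-- The ordinary category with arrows `δ₀ r, δ₁ r : r ⟶ o`. -/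
instance : Category (NShape V) where
  Hom := NShape.Hom
  id := .id
  comp := NShape.Hom.comp
  id_comp _ := rfl
  comp_id f := by cases f <;> rfl
  assoc f g h := by cases f <;> cases g <;> cases h <;> rfl

variable [CommMonoid V] [CompleteLattice V] [IsQuantale V]

/-- The unit `V`-category, with one object of self-distance `1`. -/
def unitVCat : VCat.{v, u} V := @VCat.mk V _ _ PUnit (discreteStr V PUnit)

variable {V} in
/-- The `V`-category `2_r` with objects `0` (`false`) and `1` (`true`), self-distances `1`,
distance `r` from `0` to `1` and distance `⊥` from `1` to `0`. -/
def twoVCat (r : V) : VCat.{v, u} V where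
  carrier := ULift.{u} Bool
  str :=
    { hom := fun x' x => match x'.down, x.down with
        | false, false => 1
        | true, true => 1
        | false, true => r
        | true, false => ⊥
      one_le_hom := by rintro ⟨_ | _⟩ <;> exact le_rfl
      hom_mul_hom_le := by
        rintro ⟨_ | _⟩ ⟨_ | _⟩ ⟨_ | _⟩ <;> simp }

variable {V} in
/-- The `V`-functor from the unit `V`-category that picks the object `x`. -/
def pick (X : VCat.{v, u} V) (x : X.carrier) : unitVCat.{v, u} V ⟶ X :=
  letI := discreteStr V PUnit.{u + 1}
  VFunctor.mk (fun _ => x) (fun x' y => discreteStr_vhom_le (fun _ => x) x' y)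

/-- The weight of `V`-coinserters as an ordinary functor: `o ↦ 1`, `r ↦ 2_r`, and
`δ₀ r`, `δ₁ r` act by picking `0`, `1` in `2_r`. -/
def weightFunctor : (NShape V)ᵒᵖ ⥤ VCat.{v, u} V where
  obj a := match a.unop with
    | .o => unitVCat V
    | .el r => twoVCat r
  map {a b} k := match a, b, k with
    | ⟨_⟩, ⟨_⟩, ⟨.id _⟩ => 𝟙 _
    | ⟨_⟩, ⟨_⟩, ⟨.δ₀ r⟩ => pick (twoVCat r) ⟨false⟩
    | ⟨_⟩, ⟨_⟩, ⟨.δ₁ r⟩ => pick (twoVCat r) ⟨true⟩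
  map_id _ := rfl
  map_comp {a b c} f g := by
    obtain ⟨a⟩ := a
    obtain ⟨b⟩ := b
    obtain ⟨c⟩ := c
    obtain ⟨f : NShape.Hom b a⟩ := f
    obtain ⟨g : NShape.Hom c b⟩ := g
    cases g <;> cases f <;> rfl

/-- The weight `N : 𝐍ᵒᵖ ⟶ V-cat` of `V`-coinserters. -/
def weightN : VCatFunctor V (Free V (NShape V))ᵒᵖ (VCat.{v, u} V) :=
  Free.liftOp V (weightFunctor V)

variable {V}

/-- The set `X_r` of pairs `(x', x)` with `r ≤ X(x', x)`. -/
def levelRel (X : VCat.{v, u} V) (r : V) : Type u :=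
  {p : X.carrier × X.carrier // r ≤ vhom V p.1 p.2}

/-- The nerve of `X` as an ordinary functor: `o` goes to the set of objects of `X`, `r` to `X_r`,
and `δ₀ r`, `δ₁ r` to the two projections. -/
def nerveFunctor (X : VCat.{v, u} V) : NShape V ⥤ Type u where
  obj a := match a with
    | .o => X.carrier
    | .el r => levelRel X r
  map k := match k with
    | .id _ => 𝟙 _
    | .δ₀ _ => TypeCat.ofHom fun p => p.1.1
    | .δ₁ _ => TypeCat.ofHom fun p => p.1.2
  map_id _ := rfl
  map_comp {a b c} f g := by
    change NShape.Hom a b at f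
    change NShape.Hom b c at g
    cases f <;> cases g <;> rfl

/-- The `V-cat`-functor `F_X : 𝐍 ⟶ Set`. -/
def nerve (X : VCat.{v, u} V) : VCatFunctor V (Free V (NShape V)) (SetV.{v, u} V) :=
  Free.lift V (D := SetV.{v, u} V) (nerveFunctor X)

end Nerve

end QuantaleEnriched

end

/-! The weight forces every component of an `N`-weighted cocone over `DF_X` from the one at `o`.
Such a cocone is thus a single map `g` out of `D|X|` whose composites with the two projections `DX_r
⟶ D|X|` are at distance at least `r`, for every `r`; the colimit is a coinserter
(`isWeightedColimit_iff_isCoinserter`). The counit `D|X| ⟶ X` is such a coinserter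
(`isCoinserter_counit`), so condition 2 says that `G` preserves these particular coinserters.

Everything then rests on two facts: each `h : DS ⟶ X` factors through the counit, by a map `D|h|`,
and two such `h`, `k` at distance at least `r` arise from a single map `S ⟶ X_r`. A cocone on `H`
weighted by `[D-, X]` therefore amounts to its component at the counit when `H = GD`, and the
coinserter property of `G(counit)` makes `G` the Kan extension
(`isLeftKanExtension_of_isCoinserter`). Conversely, for `L = Lan_D H`, a map out of `L(D|X|)`
satisfying the coinserter inequalities restricts along the maps `D|h|` to such a cocone, hence
extends along `L(counit)` (`IsLeftKanExtension.isCoinserter`). -/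

noncomputable section

namespace QuantaleEnriched

/-! ### Weighted colimits in terms of cocone components -/

section Comparison

variable {V : Type v} [CommMonoid V] [CompleteLattice V]

/-- A `V`-functor is an isomorphism iff it is bijective and reflects distances. -/
theorem VFunctor.isIso_iff {X : Type w} {Y : Type w'} [VCategory V X] [VCategory V Y]
    (f : VFunctor V X Y) :
    f.IsIso ↔ Function.Injective f.toFun ∧ Function.Surjective f.toFun ∧
      ∀ x' x, vhom V (f.toFun x') (f.toFun x) ≤ vhom V x' x := by
  constructor
  · rintro ⟨g, hgf, hfg⟩
    refine ⟨Function.LeftInverse.injective hgf, Function.RightInverse.surjective hfg,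
      fun x' x => ?_⟩
    simpa only [hgf] using g.vhom_le (f.toFun x') (f.toFun x)
  · rintro ⟨hi, hs, hr⟩
    choose g hg using hs
    refine ⟨⟨g, fun y' y => ?_⟩, fun x => hi (hg _), hg⟩
    simpa only [hg] using hr (g y') (g y)

variable [IsQuantale V]

variable {A : Type u₁} [Category.{v₁} A] [VCatCategory V A]
  {C : Type u₂} [Category.{u} C] [VCatCategory V C]
  {D : Type u₃} [Category.{u} D] [VCatCategory V D]

/-- The component at `w : W a` of a `W`-weighted cocone over `F`. -/
def coconeLeg {W : VCatFunctor V Aᵒᵖ (VCat.{v, u} V)} {F : VCatFunctor V A C} {c : C}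
    (γ : W ⟶ homPresheaf F c) (a : A) (w : (W.obj (op a)).carrier) : F.obj a ⟶ c :=
  VFunctor.toFun (NatTrans.app γ (op a)) w

variable {W : VCatFunctor V Aᵒᵖ (VCat.{v, u} V)} {F : VCatFunctor V A C} {c : C}

theorem cocone_ext {γ γ' : W ⟶ homPresheaf F c}
    (h : ∀ a w, coconeLeg γ a w = coconeLeg γ' a w) : γ = γ' := by
  apply NatTrans.ext
  funext a
  apply VFunctor.ext
  funext w
  exact h a.unop w

theorem coconeLeg_congr {γ γ' : W ⟶ homPresheaf F c} (h : γ = γ') (a : A)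
    (w : (W.obj (op a)).carrier) : coconeLeg γ a w = coconeLeg γ' a w := by
  rw [h]

theorem coconeLeg_map (γ : W ⟶ homPresheaf F c) {a b : A} (k : a ⟶ b)
    (w : (W.obj (op b)).carrier) :
    coconeLeg γ a ((W.map k.op).toFun w) = F.map k ≫ coconeLeg γ b w :=
  congrArg (fun t => VFunctor.toFun t w) (NatTrans.naturality γ k.op)

theorem vhom_le_coconeLeg (γ : W ⟶ homPresheaf F c) (a : A) (w w' : (W.obj (op a)).carrier) :
    vhom V w w' ≤ vhom V (coconeLeg γ a w) (coconeLeg γ a w') :=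
  VFunctor.vhom_le (NatTrans.app γ (op a)) w w'

/-- A cocone given by its components. -/
def mkCocone (leg : ∀ a, (W.obj (op a)).carrier → (F.obj a ⟶ c))
    (hleg : ∀ a w w', vhom V w w' ≤ vhom V (leg a w) (leg a w'))
    (nat : ∀ {a b : A} (k : a ⟶ b) (w : (W.obj (op b)).carrier),
      leg a ((W.map k.op).toFun w) = F.map k ≫ leg b w) : W ⟶ homPresheaf F c :=
  NatTrans.mk (fun a => VFunctor.mk (leg a.unop) (hleg a.unop)) (fun a b k => by
    apply VFunctor.ext
    funext w
    exact nat k.unop w)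

theorem coconeLeg_comp_homPresheafMap (γ : W ⟶ homPresheaf F c) {X : C} (f : c ⟶ X) (a : A)
    (w : (W.obj (op a)).carrier) :
    coconeLeg (γ ≫ homPresheafMap F f) a w = coconeLeg γ a w ≫ f := rfl

/-- The three clauses are injectivity, surjectivity and reflection of distances for the comparison
`V`-functor. Distances of cocones are infima over all components; quantifying over lower bounds `t`
avoids handling these infima later. -/
theorem isWeightedColimit_iff (γ : W ⟶ homPresheaf F c) :
    IsWeightedColimit γ ↔ ∀ X : C,
      (∀ f f' : c ⟶ X, (∀ a w, coconeLeg γ a w ≫ f = coconeLeg γ a w ≫ f') → f = f') ∧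
      (∀ σ : W ⟶ homPresheaf F X, ∃ f : c ⟶ X, ∀ a w, coconeLeg γ a w ≫ f = coconeLeg σ a w) ∧
      ∀ (f f' : c ⟶ X) (t : V),
        (∀ a w, t ≤ vhom V (coconeLeg γ a w ≫ f) (coconeLeg γ a w ≫ f')) → t ≤ vhom V f f' := by
  refine forall_congr' fun X => ?_
  rw [VFunctor.isIso_iff]
  refine and_congr ?_ (and_congr ?_ ?_)
  · exact ⟨fun h f f' hf => h (cocone_ext hf),
      fun h f f' hf => h f f' fun a w => coconeLeg_congr hf a w⟩
  · exact ⟨fun h σ => (h σ).imp fun f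
        (hf : γ ≫ homPresheafMap F f = σ) a w => coconeLeg_congr hf a w,
      fun h σ => (h σ).imp fun f hf => cocone_ext hf⟩
  · refine forall₂_congr fun f f' => ⟨fun h t ht => le_trans ?_ h, fun h => h _ fun a w => ?_⟩
    · exact le_iInf fun a => le_iInf fun w => ht a.unop w
    · exact (iInf_le _ (op a)).trans (iInf_le _ w)

/-- Weighted colimits are invariant under isomorphism of the vertex. -/
theorem IsWeightedColimit.comp_iso {γ : W ⟶ homPresheaf F c} (hγ : IsWeightedColimit γ) {d : C}
    (e : c ≅ d) : IsWeightedColimit (γ ≫ homPresheafMap F e.hom) := by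
  rw [isWeightedColimit_iff] at hγ ⊢
  simp only [coconeLeg_comp_homPresheafMap, Category.assoc]
  intro X
  obtain ⟨hi, hs, hr⟩ := hγ X
  refine ⟨fun f f' h => ?_, fun σ => ?_, fun f f' t h => ?_⟩
  · rw [← cancel_epi e.hom]
    exact hi _ _ h
  · obtain ⟨f, hf⟩ := hs σ
    exact ⟨e.inv ≫ f, fun a w => by rw [e.hom_inv_id_assoc, hf]⟩
  · simpa using (hr _ _ t h).trans (vhom_le_comp_left e.inv (e.hom ≫ f) (e.hom ≫ f'))

/-- Left Kan extensions are invariant under isomorphism. -/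
theorem IsLeftKanExtension.of_iso {J : VCatFunctor V A C} {H : VCatFunctor V A D}
    {L L' : VCatFunctor V C D} (h : IsLeftKanExtension J H L) (e : L ≅ L') :
    IsLeftKanExtension J H L' := by
  obtain ⟨γ, hγ, nat⟩ := h
  have hi : ∀ B, NatTrans.app e.hom B ≫ NatTrans.app e.inv B = 𝟙 _ := fun B =>
    congrArg (fun t => NatTrans.app t B) e.hom_inv_id
  have hi' : ∀ B, NatTrans.app e.inv B ≫ NatTrans.app e.hom B = 𝟙 _ := fun B =>
    congrArg (fun t => NatTrans.app t B) e.inv_hom_id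
  refine ⟨fun B => γ B ≫ homPresheafMap H (NatTrans.app e.hom B), fun B =>
    (hγ B).comp_iso ⟨_, _, hi B, hi' B⟩, fun B B' k => cocone_ext fun a w => ?_⟩
  have h₁ : coconeLeg (γ B') a (w ≫ k) = coconeLeg (γ B) a w ≫ L.map k :=
    coconeLeg_congr (nat B B' k) a w
  change coconeLeg (γ B') a (w ≫ k) ≫ NatTrans.app e.hom B' =
    (coconeLeg (γ B) a w ≫ NatTrans.app e.hom B) ≫ L'.map k
  rw [h₁, Category.assoc, Category.assoc]
  exact congrArg _ (NatTrans.naturality e.hom k)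

end Comparison

/-! ### Coinserters and colimits weighted by `N` -/

section Coinserter

variable {V : Type u} [CommMonoid V] [CompleteLattice V]
  {C : Type u₂} [Category.{u} C] [VCatCategory V C]
  {D : Type u₃} [Category.{u} D] [VCatCategory V D]

/-- `j` is universal among the arrows out of `B` with `r ≤ C(A r, c)(d₀ r ≫ j, d₁ r ≫ j)` for
all `r`. -/
structure IsCoinserter {A : V → C} {B : C} (d₀ d₁ : ∀ r, A r ⟶ B) {c : C} (j : B ⟶ c) :
    Prop where
  le : ∀ r, r ≤ vhom V (d₀ r ≫ j) (d₁ r ≫ j)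
  -- Not a consequence of `vhom_le`: `V`-categories need not be separated, so distinct arrows may be
  -- at distance at least `1` both ways.
  hom_ext : ∀ {X : C} (f f' : c ⟶ X), j ≫ f = j ≫ f' → f = f'
  vhom_le : ∀ {X : C} (f f' : c ⟶ X), vhom V (j ≫ f) (j ≫ f') ≤ vhom V f f'
  exists_desc : ∀ {X : C} (g : B ⟶ X),
    (∀ r, r ≤ vhom V (d₀ r ≫ g) (d₁ r ≫ g)) → ∃ f : c ⟶ X, j ≫ f = g

section

variable {A : V → C} {B : C} {d₀ d₁ : ∀ r, A r ⟶ B} {c d : C}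

/-- Two coinserters of the same diagram are isomorphic. -/
theorem IsCoinserter.exists_iso {j : B ⟶ c} (hj : IsCoinserter d₀ d₁ j)
    {j' : B ⟶ d} (hj' : IsCoinserter d₀ d₁ j') : ∃ e : c ≅ d, j ≫ e.hom = j' := by
  obtain ⟨f, hf⟩ := hj.exists_desc j' hj'.le
  obtain ⟨f', hf'⟩ := hj'.exists_desc j hj.le
  exact ⟨⟨f, f', hj.hom_ext _ _ (by rw [← Category.assoc, hf, hf', Category.comp_id]),
    hj'.hom_ext _ _ (by rw [← Category.assoc, hf', hf, Category.comp_id])⟩, hf⟩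

variable [IsQuantale V]

theorem IsCoinserter.comp_iso {j : B ⟶ c} (hj : IsCoinserter d₀ d₁ j) (e : c ≅ d) :
    IsCoinserter d₀ d₁ (j ≫ e.hom) where
  le r := by
    rw [← Category.assoc, ← Category.assoc]
    exact (hj.le r).trans (vhom_le_comp_right _ _ _)
  hom_ext f f' h := by
    rw [← cancel_epi e.hom]
    exact hj.hom_ext _ _ (by simpa using h)
  vhom_le f f' := by
    rw [Category.assoc, Category.assoc]
    simpa using (hj.vhom_le (e.hom ≫ f) (e.hom ≫ f')).trans
      (vhom_le_comp_left e.inv (e.hom ≫ f) (e.hom ≫ f'))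
  exists_desc g hg := by
    obtain ⟨f, hf⟩ := hj.exists_desc g hg
    exact ⟨e.inv ≫ f, by simpa using hf⟩

end

variable [IsQuantale V]

variable (V) in
/-- The object `o` of the free `V-cat`-category on the shape of `V`-coinserters. -/
def vertexObj : Free V (NShape V) := NShape.o

/-- The object `r` of the free `V-cat`-category on the shape of `V`-coinserters. -/
def levelObj (r : V) : Free V (NShape V) := NShape.el r

/-- The arrow `δ₀ r` of the free `V-cat`-category on the shape of `V`-coinserters. -/
def arrow₀ (r : V) : levelObj r ⟶ vertexObj V := NShape.Hom.δ₀ r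

/-- The arrow `δ₁ r` of the free `V-cat`-category on the shape of `V`-coinserters. -/
def arrow₁ (r : V) : levelObj r ⟶ vertexObj V := NShape.Hom.δ₁ r

variable {E : VCatFunctor V (Free V (NShape V)) C} {c : C}

/-- The component at `o` of a cocone weighted by the weight of `V`-coinserters. -/
def vertexLeg (γ : weightN.{u, u} V ⟶ homPresheaf E c) : E.obj (vertexObj V) ⟶ c :=
  coconeLeg γ (vertexObj V) PUnit.unit

/-- Naturality along `δ₀ r`, which the weight sends to the inclusion of the object `0` of `2_r`. -/
theorem coconeLeg_false (γ : weightN.{u, u} V ⟶ homPresheaf E c) (r : V) :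
    coconeLeg γ (levelObj r) ⟨false⟩ = E.map (arrow₀ r) ≫ vertexLeg γ :=
  coconeLeg_map γ (arrow₀ r) PUnit.unit

theorem coconeLeg_true (γ : weightN.{u, u} V ⟶ homPresheaf E c) (r : V) :
    coconeLeg γ (levelObj r) ⟨true⟩ = E.map (arrow₁ r) ≫ vertexLeg γ :=
  coconeLeg_map γ (arrow₁ r) PUnit.unit

theorem le_vhom_vertexLeg (γ : weightN.{u, u} V ⟶ homPresheaf E c) (r : V) :
    r ≤ vhom V (E.map (arrow₀ r) ≫ vertexLeg γ) (E.map (arrow₁ r) ≫ vertexLeg γ) := by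
  rw [← coconeLeg_false, ← coconeLeg_true]
  exact vhom_le_coconeLeg γ (levelObj r) ⟨false⟩ ⟨true⟩

/-- The components of the cocone determined by its component at `o`. -/
def coinserterLeg (g : E.obj (vertexObj V) ⟶ c) :
    ∀ a : Free V (NShape V), ((weightN.{u, u} V).obj (op a)).carrier → (E.obj a ⟶ c)
  | .o, _ => g
  | .el r, ⟨false⟩ => E.map (arrow₀ r) ≫ g
  | .el r, ⟨true⟩ => E.map (arrow₁ r) ≫ g

/-- The cocone determined by its component at `o`. -/
def coinserterCocone (g : E.obj (vertexObj V) ⟶ c)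
    (hg : ∀ r, r ≤ vhom V (E.map (arrow₀ r) ≫ g) (E.map (arrow₁ r) ≫ g)) :
    weightN.{u, u} V ⟶ homPresheaf E c :=
  mkCocone (coinserterLeg g)
    (by
      rintro (_ | r)
      · rintro ⟨⟩ ⟨⟩
        exact (discreteStr_hom_self V PUnit.unit).le.trans (VCategory.one_le_hom _)
      · rintro ⟨_ | _⟩ ⟨_ | _⟩
        · exact VCategory.one_le_hom (V := V) (E.map (arrow₀ r) ≫ g)
        · exact hg r
        · exact bot_le
        · exact VCategory.one_le_hom (V := V) (E.map (arrow₁ r) ≫ g))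
    (by
      intro a b k w
      change NShape.Hom a b at k
      cases k with
      | id a =>
        change coinserterLeg g a w = E.map (𝟙 _) ≫ coinserterLeg g a w
        rw [E.map_id, Category.id_comp]
      | δ₀ r => rfl
      | δ₁ r => rfl)

/-- Case principle: the weight has only the point over `o` and the two objects of each `2_r`, and
the components at the latter are forced. -/
theorem forall_coconeLeg {γ : weightN.{u, u} V ⟶ homPresheaf E c}
    {P : ∀ (a : Free V (NShape V)) (_ : ((weightN.{u, u} V).obj (op a)).carrier),
      (E.obj a ⟶ c) → Prop}
    (h : P (vertexObj V) PUnit.unit (vertexLeg γ))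
    (h₀ : ∀ r, P (levelObj r) ⟨false⟩ (E.map (arrow₀ r) ≫ vertexLeg γ))
    (h₁ : ∀ r, P (levelObj r) ⟨true⟩ (E.map (arrow₁ r) ≫ vertexLeg γ)) :
    ∀ a w, P a w (coconeLeg γ a w) := by
  rintro (_ | r)
  · rintro ⟨⟩
    exact h
  · rintro ⟨_ | _⟩
    · exact (coconeLeg_false γ r).symm ▸ h₀ r
    · exact (coconeLeg_true γ r).symm ▸ h₁ r

/-- Colimits weighted by the weight of `V`-coinserters in terms of the component at `o`. -/
theorem isWeightedColimit_iff_isCoinserter (γ : weightN.{u, u} V ⟶ homPresheaf E c) :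
    IsWeightedColimit γ ↔
      IsCoinserter (fun r => E.map (arrow₀ r)) (fun r => E.map (arrow₁ r)) (vertexLeg γ) := by
  rw [isWeightedColimit_iff]
  constructor
  · intro h
    refine ⟨le_vhom_vertexLeg γ, fun {X} f f' hf => (h X).1 f f' ?_,
      fun {X} f f' => (h X).2.2 f f' _ ?_, fun {X} g hg => ?_⟩
    · refine forall_coconeLeg (P := fun a _ g => g ≫ f = g ≫ f') hf (fun r => ?_) fun r => ?_ <;>
        rw [Category.assoc, Category.assoc, hf]
    · refine forall_coconeLeg (P := fun a _ g => _ ≤ vhom V (g ≫ f) (g ≫ f')) le_rfl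
        (fun r => ?_) fun r => ?_ <;>
      · rw [Category.assoc, Category.assoc]
        exact vhom_le_comp_left _ _ _
    · obtain ⟨f, hf⟩ := (h X).2.1 (coinserterCocone g hg)
      exact ⟨f, hf (vertexObj V) PUnit.unit⟩
  · intro h X
    refine ⟨fun f f' hf => h.hom_ext f f' (hf _ _), fun σ => ?_,
      fun f f' t ht => (ht _ _).trans (h.vhom_le f f')⟩
    obtain ⟨f, hf⟩ := h.exists_desc (vertexLeg σ) (le_vhom_vertexLeg σ)
    refine ⟨f, forall_coconeLeg (P := fun a w g => g ≫ f = coconeLeg σ a w) hf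
      (fun r => ?_) fun r => ?_⟩
    · rw [coconeLeg_false, Category.assoc, hf]
    · rw [coconeLeg_true, Category.assoc, hf]

/-- Given one coinserter of the diagram `E`, the functor `G` preserves the colimit iff it
preserves that coinserter. -/
theorem preservesWeightedColimit_iff {j : E.obj (vertexObj V) ⟶ c}
    (hj : IsCoinserter (fun r => E.map (arrow₀ r)) (fun r => E.map (arrow₁ r)) j)
    (G : VCatFunctor V C D) :
    PreservesWeightedColimit G (weightN.{u, u} V) E ↔
      IsCoinserter (fun r => G.map (E.map (arrow₀ r))) (fun r => G.map (E.map (arrow₁ r)))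
        (G.map j) := by
  constructor
  · intro h
    exact (isWeightedColimit_iff_isCoinserter _).1 (h c (coinserterCocone j hj.le)
      ((isWeightedColimit_iff_isCoinserter _).2 hj))
  · intro h d γ hγ
    rw [isWeightedColimit_iff_isCoinserter] at hγ ⊢
    -- An arbitrary colimit cocone differs from the given coinserter by an isomorphism, which `G`
    -- carries along.
    obtain ⟨e, he⟩ := hj.exists_iso hγ
    have := h.comp_iso (G.mapIso e)
    rw [Functor.mapIso_hom, ← G.map_comp, he] at this
    exact this

end Coinserter

/-! ### A `V`-category as the coinserter of its nerve -/

section Nerve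

variable {V : Type u} [CommMonoid V] [CompleteLattice V] [IsQuantale V]

/-- The set of objects of `X`. -/
def objSet (X : VCat.{u, u} V) : SetV.{u, u} V := X.carrier

/-- The function on objects underlying an arrow of `V-cat`. -/
def VCat.fn {X Y : VCat.{u, u} V} (f : X ⟶ Y) : X.carrier → Y.carrier := f.toFun

/-- The function underlying a `V`-functor out of a discrete `V`-category. -/
def underlying {S : SetV.{u, u} V} {X : VCat.{u, u} V} (h : (disc V).obj S ⟶ X) :
    S ⟶ objSet X :=
  TypeCat.ofHom (VCat.fn h)

/-- The counit `D |X| ⟶ X`. -/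
def counit (X : VCat.{u, u} V) : (disc V).obj (objSet X) ⟶ X :=
  @VFunctor.mk V _ _ X.carrier X.carrier (discreteStr V X.carrier) _ (fun x => x)
    (discreteStr_vhom_le fun x => x)

/-- The counit is the identity on objects, and any function between discrete `V`-categories is a
`V`-functor. -/
theorem map_underlying_comp_counit {S : SetV.{u, u} V} {X : VCat.{u, u} V}
    (h : (disc V).obj S ⟶ X) : (disc V).map (underlying h) ≫ counit X = h := rfl

theorem map_underlying_map_comp {S T : SetV.{u, u} V} {X : VCat.{u, u} V} (m : S ⟶ T)
    (h : (disc V).obj T ⟶ X) :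
    (disc V).map (underlying ((disc V).map m ≫ h)) =
      (disc V).map m ≫ (disc V).map (underlying h) := rfl

variable (X : VCat.{u, u} V)

/-- The set of pairs of objects of `X` at distance at least `r`. -/
def levelSet (r : V) : SetV.{u, u} V := levelRel X r

/-- The projection `(x', x) ↦ x'`. -/
def proj₀ (r : V) : levelSet X r ⟶ objSet X := (nerve X).map (arrow₀ r)

/-- The projection `(x', x) ↦ x`. -/
def proj₁ (r : V) : levelSet X r ⟶ objSet X := (nerve X).map (arrow₁ r)

variable {X} in
/-- The function to `X_r` given by two functions at distance at least `r`. -/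
def pairing {S : SetV.{u, u} V} (h k : (disc V).obj S ⟶ X) {r : V} (hr : r ≤ vhom V h k) :
    S ⟶ levelSet X r :=
  TypeCat.ofHom fun s => ⟨(VCat.fn h s, VCat.fn k s), hr.trans (iInf_le _ s)⟩

variable {X} in
-- With its companion for `proj₁`, this makes `X_r` universal among pairs at distance at least `r`:
-- an inequality for the projections passes to every such pair.
theorem map_pairing_comp_proj₀ {S : SetV.{u, u} V} (h k : (disc V).obj S ⟶ X) {r : V}
    (hr : r ≤ vhom V h k) :
    (disc V).map (pairing h k hr) ≫ (disc V).map (proj₀ X r) = (disc V).map (underlying h) := rfl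

variable {X} in
theorem map_pairing_comp_proj₁ {S : SetV.{u, u} V} (h k : (disc V).obj S ⟶ X) {r : V}
    (hr : r ≤ vhom V h k) :
    (disc V).map (pairing h k hr) ≫ (disc V).map (proj₁ X r) = (disc V).map (underlying k) := rfl

theorem le_vhom_map_proj_iff {Y : VCat.{u, u} V} (g : (disc V).obj (objSet X) ⟶ Y) (r : V) :
    r ≤ vhom V ((disc V).map (proj₀ X r) ≫ g) ((disc V).map (proj₁ X r) ≫ g) ↔
      ∀ x' x : X.carrier, r ≤ vhom V x' x →
        r ≤ vhom V (VCat.fn g x') (VCat.fn g x) := by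
  refine (le_iInf_iff (α := V)).trans ⟨fun h x' x hr => h ⟨(x', x), hr⟩, fun h p => ?_⟩
  exact h (Subtype.val p).1 (Subtype.val p).2 (Subtype.property p)

/-- Every `V`-category is the coinserter of its nerve. -/
theorem isCoinserter_counit :
    IsCoinserter (fun r => (disc V).map (proj₀ X r)) (fun r => (disc V).map (proj₁ X r))
      (counit X) where
  le r := (le_vhom_map_proj_iff X (counit X) r).2 fun _ _ hr => hr
  hom_ext f f' h := by
    apply VFunctor.ext
    funext x
    exact congrFun (congrArg VCat.fn h) x
  -- Both distances are infima over the same set of objects.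
  vhom_le f f' := le_rfl
  exists_desc g hg :=
    -- The inequality for `r = X(x', x)` is the `V`-functor condition at `(x', x)`.
    ⟨VFunctor.mk (VCat.fn (X := (disc V).obj (objSet X)) g) fun x' x =>
      (le_vhom_map_proj_iff X g _).1 (hg _) x' x le_rfl, rfl⟩

end Nerve

/-! ### Kan extensions along `D` and coinserters of nerves -/

section Kan

variable {V : Type u} [CommMonoid V] [CompleteLattice V] [IsQuantale V]
  {C : Type u₃} [Category.{u} C] [VCatCategory V C]

/-- A functor that preserves the coinserters of nerves is the left Kan extension of its
restriction to discrete `V`-categories. -/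
theorem isLeftKanExtension_of_isCoinserter (G : VCatFunctor V (VCat.{u, u} V) C)
    (hG : ∀ X, IsCoinserter (fun r => G.map ((disc V).map (proj₀ X r)))
      (fun r => G.map ((disc V).map (proj₁ X r))) (G.map (counit X))) :
    IsLeftKanExtension (disc V) ((disc V).comp G) G := by
  refine ⟨mapHomPresheaf (disc V) G, fun B => ?_, fun B B' k =>
    cocone_ext fun S h => G.map_comp h k⟩
  rw [isWeightedColimit_iff]
  intro Y
  refine ⟨fun f f' h => (hG B).hom_ext f f' (h (objSet B) (counit B)), fun σ => ?_,
    fun f f' t h => (h (objSet B) (counit B)).trans ((hG B).vhom_le f f')⟩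
  -- Naturality in `S` determines `σ` from its component at the counit.
  have key : ∀ {S : SetV.{u, u} V} (m : S ⟶ objSet B),
      coconeLeg σ S ((disc V).map m ≫ counit B) =
        G.map ((disc V).map m) ≫ coconeLeg σ (objSet B) (counit B) := fun m =>
    coconeLeg_map σ m (counit B)
  -- The coinserter inequality comes from `V`-functoriality of `σ` at the set `B_r`, applied to the
  -- two projections followed by the counit.
  obtain ⟨f, hf⟩ := (hG B).exists_desc (coconeLeg σ (objSet B) (counit B)) fun r =>
    (((isCoinserter_counit B).le r).trans (vhom_le_coconeLeg σ (levelSet B r) _ _)).trans_eq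
      (congrArg₂ (vhom V) (key (proj₀ B r)) (key (proj₁ B r)))
  refine ⟨f, fun S h => ?_⟩
  have hh : ∀ h : (disc V).obj S ⟶ B,
      G.map ((disc V).map (underlying h)) ≫ coconeLeg σ (objSet B) (counit B) = G.map h ≫ f := by
    intro h
    rw [← hf, ← Category.assoc, ← G.map_comp, map_underlying_comp_counit]
  exact ((key (underlying h)).trans (hh h)).symm

/-- Left Kan extensions along `D` preserve the coinserters of nerves. -/
theorem IsLeftKanExtension.isCoinserter {H : VCatFunctor V (SetV.{u, u} V) C}
    {L : VCatFunctor V (VCat.{u, u} V) C} (hL : IsLeftKanExtension (disc V) H L)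
    (X : VCat.{u, u} V) : IsCoinserter (fun r => L.map ((disc V).map (proj₀ X r)))
      (fun r => L.map ((disc V).map (proj₁ X r))) (L.map (counit X)) := by
  obtain ⟨γ, hγ, nat⟩ := hL
  replace hγ := fun B => (isWeightedColimit_iff (γ B)).1 (hγ B)
  let η : ∀ {B : VCat.{u, u} V} {S : SetV.{u, u} V} (h : (disc V).obj S ⟶ B),
    H.obj S ⟶ L.obj B := fun {B S} h => coconeLeg (γ B) S h
  have natL : ∀ {B B' : VCat.{u, u} V} (k : B ⟶ B') {S : SetV.{u, u} V}
      (h : (disc V).obj S ⟶ B), η (h ≫ k) = η h ≫ L.map k := fun {B B'} k S h =>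
    coconeLeg_congr (nat B B' k) S h
  have natS : ∀ {B : VCat.{u, u} V} {S T : SetV.{u, u} V} (m : S ⟶ T)
      (h : (disc V).obj T ⟶ B), η ((disc V).map m ≫ h) = H.map m ≫ η h :=
    fun {B S T} m h => coconeLeg_map (γ B) m h
  -- All components of the colimit cocone at `X` factor through `L(counit)`, so uniqueness and
  -- reflection of distances pass to it.
  have leg : ∀ (S : SetV.{u, u} V) (h : (disc V).obj S ⟶ X),
      η h = η ((disc V).map (underlying h)) ≫ L.map (counit X) := fun S h =>
    natL (counit X) ((disc V).map (underlying h))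
  refine ⟨fun r => ?_, fun {Y} f f' h => ?_, fun {Y} f f' => ?_, fun {Y} g hg => ?_⟩
  · rw [← L.map_comp, ← L.map_comp]
    exact ((isCoinserter_counit X).le r).trans (L.vhom_le_map _ _)
  · refine (hγ X Y).1 f f' fun S k => ?_
    change η k ≫ f = η k ≫ f'
    rw [leg S k, Category.assoc, Category.assoc, h]
  · refine (hγ X Y).2.2 f f' _ fun S k => ?_
    change _ ≤ vhom V (η k ≫ f) (η k ≫ f')
    rw [leg S k, Category.assoc, Category.assoc]
    exact vhom_le_comp_left _ _ _
  -- Pairing `h` and `k` into `X_r` with `r` their exact distance reduces this to the hypothesis on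
  -- `g`.
  · have hη : ∀ {S : SetV.{u, u} V} (h k : (disc V).obj S ⟶ X), vhom V h k ≤
        vhom V (η ((disc V).map (underlying h)) ≫ g) (η ((disc V).map (underlying k)) ≫ g) := by
      intro S h k
      rw [← map_pairing_comp_proj₀ h k le_rfl, ← map_pairing_comp_proj₁ h k le_rfl, natL, natL,
        Category.assoc, Category.assoc]
      exact (hg _).trans (vhom_le_comp_left _ _ _)
    have hnat : ∀ {S T : SetV.{u, u} V} (m : S ⟶ T) (h : (disc V).obj T ⟶ X),
        η ((disc V).map (underlying ((disc V).map m ≫ h))) ≫ g =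
          H.map m ≫ η ((disc V).map (underlying h)) ≫ g := by
      intro S T m h
      rw [map_underlying_map_comp, natS, Category.assoc]
    obtain ⟨f, hf⟩ := (hγ X Y).2.1 (mkCocone
      (fun S h => η ((disc V).map (underlying h)) ≫ g) (fun S h k => hη h k) hnat)
    -- Equality of maps out of `L(D|X|)` is tested on its own colimit cocone, indexed by `q : DS ⟶
    -- D|X|`; the map underlying `q ≫ counit X` gives back `q`.
    refine ⟨f, (hγ _ Y).1 _ _ fun S q => ?_⟩
    change η q ≫ L.map (counit X) ≫ f = η q ≫ g
    exact ((Category.assoc _ _ _).symm.trans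
      (congrArg (fun t => t ≫ f) (natL (counit X) q).symm)).trans (hf S _)

end Kan

end QuantaleEnriched

end

theorem theorem3p16 {V : Type u} [CommMonoid V] [CompleteLattice V] [IsQuantale V] [Nontrivial V]
    (hV : (1 : V) = ⊤)
    (G : QuantaleEnriched.VCatFunctor V
      (QuantaleEnriched.VCat.{u, u} V) (QuantaleEnriched.VCat.{u, u} V)) :
    (∃ (H : QuantaleEnriched.VCatFunctor V
          (QuantaleEnriched.SetV.{u, u} V) (QuantaleEnriched.VCat.{u, u} V))
        (L : QuantaleEnriched.VCatFunctor V
          (QuantaleEnriched.VCat.{u, u} V) (QuantaleEnriched.VCat.{u, u} V)),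
        QuantaleEnriched.IsLeftKanExtension (QuantaleEnriched.disc V) H L ∧ Nonempty (G ≅ L)) ↔
      ∀ X : QuantaleEnriched.VCat.{u, u} V,
        QuantaleEnriched.PreservesWeightedColimit G (QuantaleEnriched.weightN V)
          ((QuantaleEnriched.nerve X).comp (QuantaleEnriched.disc V)) := by
  have hpres := fun X : QuantaleEnriched.VCat.{u, u} V =>
    QuantaleEnriched.preservesWeightedColimit_iff
      (E := (QuantaleEnriched.nerve X).comp (QuantaleEnriched.disc V))
      (QuantaleEnriched.isCoinserter_counit X) G
  constructor
  · rintro ⟨H, L, hL, ⟨e⟩⟩ X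
    exact (hpres X).2 ((hL.of_iso e.symm).isCoinserter X)
  · intro h
    -- The witness for `H` is the restriction of `G` to discrete `V`-categories.
    exact ⟨_, G, QuantaleEnriched.isLeftKanExtension_of_isCoinserter G fun X => (hpres X).1 (h X),
      ⟨Iso.refl G⟩⟩
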